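/- Conventions. Graphs are finite, simple and undirected. A perfect code in a graph is an independent set $D$ of vertices such that every vertex outside $D$ is adjacent to exactly one vertex of $D$. For $S\subseteq\mathbb{Z}_n\setminus\{0\}$ with $-S=S$, $\mathrm{Cay}(\mathbb{Z}_n,S)$ is the graph on $\mathbb{Z}_n$ in which $x,y$ are adjacent if and only if $x-y\in S$; graphs (isomorphic to one) of this form are the circulant graphs of order $n$. Put $S_0=S\cup\{0\}$ and identify elements of $\mathbb{Z}_n$ with integers in $\{0,\dots,n-1\}$. Let $\Gamma=\mathrm{Cay}(\mathbb{Z}_n,S)$ and let $a\ge 1$ be an integer. - A map $\sigma:S_0\to\{0,\dots,a-1\}$ is feasible if $\sigma(0)=0$ and the set $T(\sigma)=\{s+\sigma(s)n: s\in S\}\subseteq\mathbb{Z}_{an}$ satisfies $-T(\sigma)=T(\sigma)$. Let $\bar f_a(\Gamma)=\{\mathrm{Cay}(\mathbb{Z}_{an},T(\sigma)):\sigma\text{ feasible}\}$. - Let $\bar g_a(\Gamma)=\mathrm{Cay}(\mathbb{Z}_{an},T_0\setminus\{0\})$, where $T_0=\{s+in: s\in S_0,\ 0\le i\le a-1\}$.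 Let $p$ be a prime, let $\mathbf l=(\ell_1,\dots,\ell_t)$ and $\mathbf m=(m_1,\dots,m_t)$, $t\ge1$, be sequences of positive integers, and put $\ell=\sum_i\ell_i$, $m=\prod_i m_i$, $n=p^\ell m$. Let $K_{p^{\ell_t}}=\mathrm{Cay}(\mathbb{Z}_{p^{\ell_t}},\mathbb{Z}_{p^{\ell_t}}\setminus\{0\})$. Denote by $\mathcal G_{\mathbf l,\mathbf m}(n,p^\ell)$ the family of all graphs $\Gamma_1$ that arise as follows: choose a connected graph $\Gamma_t\in\bar f_{m_t}(K_{p^{\ell_t}})$ and then, for $i=t-1,t-2,\dots,1$ successively, choose a connected graph $\Gamma_i\in\bar f_{m_i}\bigl(\bar g_{p^{\ell_i}}(\Gamma_{i+1})\bigr)$. Theorem 1.3. Let $n=p^\ell m$, where $p$ is a prime and $\ell\ge 1$, $m\ge 2$ are integers. Then a connected circulant graph with order $n$ and degree $p^\ell-1$ admits a perfect code if and only if it is isomorphic to a graph in $\mathcal G_{\mathbf l,\mathbf m}(n,p^\ell)$ for some sequences $\mathbf l=(\ell_1,\dots,\ell_t)$ and $\mathbf m=(m_1,\dots,m_t)$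 of positive integers satisfying $\sum_{i=1}^t\ell_i=\ell$ and $\prod_{i=1}^t m_i=m$. -/

import Mathlib

namespace PerfectCirculant

/-- A perfect code of a graph: an independent set `D` such that every vertex outside `D` is
adjacent to exactly one vertex of `D`. -/
def IsPerfectCode {V : Type*} (Γ : SimpleGraph V) (D : Set V) : Prop :=
  Γ.IsIndepSet D ∧ ∀ v, v ∉ D → ∃! d, d ∈ D ∧ Γ.Adj v d

/-- `S` is a connection set: an inverse-closed set not containing the identity. -/
def IsConnectionSet {G : Type*} [AddGroup G] (S : Set G) : Prop :=
  (0 : G) ∉ S ∧ ∀ x ∈ S, -x ∈ S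

/-- The extended connection set `S₀ = S ∪ {0}`. -/
def extSet {G : Type*} [AddGroup G] (S : Set G) : Set G := insert 0 S

/-- `Γ` is a circulant graph of order `n` (used for `n ≥ 1`): a Cayley graph `Cay(ℤ/n, S)`, up to
relabelling the vertices. For a connection set `S`, the graph
`SimpleGraph.circulantGraph S` joins `x` and `y` exactly when `x - y ∈ S`. -/
def IsCirculant {V : Type*} (Γ : SimpleGraph V) (n : ℕ) : Prop :=
  ∃ S : Set (ZMod n), IsConnectionSet S ∧ Nonempty (Γ ≃g SimpleGraph.circulantGraph S)

/-- The set `T(σ) = {s + σ(s) n : s ∈ S} ⊆ ℤ/(mn)`, where the elements of `ℤ/n` are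
identified with their representatives in `{0, …, n-1}`. -/
def liftSet (m : ℕ) {n : ℕ} (S : Set (ZMod n)) (σ : ZMod n → ℕ) : Set (ZMod (m * n)) :=
  {x | ∃ s ∈ S, x = ((s.val + σ s * n : ℕ) : ZMod (m * n))}

/-- `σ : S₀ → {0, …, m-1}` is feasible: `σ(0) = 0` and `-T(σ) = T(σ)`. The values of `σ` outside
`S₀` play no role. -/
def IsFeasible (m : ℕ) {n : ℕ} (S : Set (ZMod n)) (σ : ZMod n → ℕ) : Prop :=
  (∀ s ∈ extSet S, σ s < m) ∧ σ 0 = 0 ∧ ∀ x ∈ liftSet m S σ, -x ∈ liftSet m S σ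

/-- The connection sets of the circulant graphs of order `mn` in the family `f̄ₘ(Cay(ℤ/n, S))`. -/
def fbar (m : ℕ) {n : ℕ} (S : Set (ZMod n)) : Set (Set (ZMod (m * n))) :=
  {T | ∃ σ : ZMod n → ℕ, IsFeasible m S σ ∧ T = liftSet m S σ}

/-- The connection set of the circulant graph `ḡₘ(Cay(ℤ/n, S))` of order `mn`, whose extended
connection set is `{s + i n : s ∈ S₀, 0 ≤ i ≤ m-1}`. -/
def gbar (m : ℕ) {n : ℕ} (S : Set (ZMod n)) : Set (ZMod (m * n)) :=
  {x | ∃ s ∈ extSet S, ∃ i < m, x = ((s.val + i * n : ℕ) : ZMod (m * n))} \ {0}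

/-- `IsLift p (ℓ₁, …, ℓₜ) (m₁, …, mₜ) n T`: the connected circulant graph `Cay(ℤ/n, T)` is
obtained from the complete graph on `ℤ/p^{ℓₜ}` by choosing a connected `Γₜ ∈ f̄_{mₜ}(K_{p^{ℓₜ}})`
and then, for `i = t-1, …, 1`, a connected `Γᵢ ∈ f̄_{mᵢ}(ḡ_{p^{ℓᵢ}}(Γᵢ₊₁))`; the result is `Γ₁`. -/
inductive IsLift (p : ℕ) : List ℕ → List ℕ → (n : ℕ) → Set (ZMod n) → Prop
  | base (r m : ℕ) (T : Set (ZMod (m * p ^ r)))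
      (hT : T ∈ fbar m ({0}ᶜ : Set (ZMod (p ^ r))))
      (hc : (SimpleGraph.circulantGraph T).Connected) :
      IsLift p [r] [m] (m * p ^ r) T
  | step (a m : ℕ) (l k : List ℕ) (n : ℕ) (S : Set (ZMod n)) (hS : IsLift p l k n S)
      (T : Set (ZMod (m * (p ^ a * n)))) (hT : T ∈ fbar m (gbar (p ^ a) S))
      (hc : (SimpleGraph.circulantGraph T).Connected) :
      IsLift p (a :: l) (m :: k) (m * (p ^ a * n)) T

/-- The family `𝒢_{l,k}(n, p^ℓ)` of circulant graphs, for sequences `l = (ℓ₁, …, ℓₜ)` and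
`k = (m₁, …, mₜ)` of positive integers with `ℓ = ℓ₁ + ⋯ + ℓₜ` and `n = p^ℓ m₁ ⋯ mₜ`. -/
def liftFamily (p : ℕ) (l k : List ℕ) (n : ℕ) : Set (SimpleGraph (ZMod n)) :=
  {Λ | ∃ T : Set (ZMod n), IsLift p l k n T ∧ Λ = SimpleGraph.circulantGraph T}

end PerfectCirculant

/-! A perfect code in `Cay(ℤ/n, S)` is a set `D` for which every element is uniquely a sum from `S₀`
and `D` (`isPerfectCode_circulantGraph_iff`). Both lifting operations preserve such tilings
(`Tiles.fbar`, `Tiles.gbar`), which gives one direction.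

For the other, let `p ^ N` be the exact power of `p` in `n`. For `1 ≤ e ≤ N` the cyclotomic
polynomial of order `p ^ e` divides the mask polynomial of `S₀` or that of `D`. Its value at 1 is
`p`, so `|S₀| = p ^ ℓ` leaves exactly `ℓ` exponents for `S₀`, forming a set `E`
(`exists_cyclotomic_exponents`). If `e + 1 ∈ E`, each class of `S₀` modulo `p ^ e` splits evenly
into all `p` classes above it (`classCard_eq_mul`). These splittings already account for all `p ^ ℓ`
elements, so no class splits at the other levels and `S₀` injects modulo `p ^ N`.

Reading the levels upward, a splitting level is a `ḡ_p` and the rigid stretch after it an `f̄`, the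
last one absorbing the part of `n` prime to `p` (`exists_isLift_residues`). Every `ℓᵢ` produced is
1; connectedness forces `1 ∈ E`, so the construction starts from the complete graph on `ℤ/p`. -/

open Polynomial

namespace PerfectCirculant

/-! ### Cyclotomic divisibility and equidistribution in residue classes -/

/-- The number of elements of `A` congruent to `r` modulo `p ^ e`. -/
def classCard (p : ℕ) (A : Finset ℕ) (e : ℕ) (r : ℤ) : ℕ :=
  (A.filter fun a : ℕ => (a : ZMod (p ^ e)) = (r : ZMod (p ^ e))).card

/-- Since `Φ_q * (X ^ (p ^ e) - 1) = X ^ q - 1` for `q = p ^ (e + 1)`, the image of the mask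
polynomial in the group ring of `ℤ/q` is invariant under translation by `p ^ e`; its coefficients
are the class counts. -/
theorem classCard_add_pow {p e : ℕ} [Fact p.Prime] {A : Finset ℕ}
    (h : cyclotomic (p ^ (e + 1)) ℤ ∣ ∑ a ∈ A, X ^ a) (r : ℤ) :
    classCard p A (e + 1) (r + p ^ e) = classCard p A (e + 1) r := by
  obtain ⟨Q, hQ⟩ := h
  unfold classCard
  set q := p ^ (e + 1) with hq
  let φ : ℤ[X] →ₐ[ℤ] AddMonoidAlgebra ℤ (ZMod q) := aeval (AddMonoidAlgebra.single 1 1)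
  have hX : ∀ j : ℕ, φ (X ^ j) = AddMonoidAlgebra.single (j : ZMod q) 1 := by
    intro j
    simp [φ, AddMonoidAlgebra.single_pow]
  have h1 : (∑ a ∈ A, X ^ a : ℤ[X]) * X ^ (p ^ e) = (∑ a ∈ A, X ^ a) + (X ^ q - 1) * Q := by
    rw [hQ, hq, ← cyclotomic_prime_pow_mul_X_pow_sub_one]
    ring
  have h2 := congrArg φ h1
  simp only [map_mul, map_add, map_sub, map_sum, hX, map_one, CharP.cast_eq_zero] at h2
  rw [← AddMonoidAlgebra.one_def, sub_self, zero_mul, add_zero, Finset.sum_mul] at h2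
  simp only [AddMonoidAlgebra.single_mul_single, mul_one] at h2
  have h3 := congrArg (fun x => x.coeff ((r : ZMod q) + (p ^ e : ℕ))) h2
  simp only [AddMonoidAlgebra.coeff_sum, AddMonoidAlgebra.coeff_single, Finsupp.finsetSum_apply,
    Finsupp.single_apply, add_left_inj, Finset.sum_boole] at h3
  push_cast at h3 ⊢
  exact_mod_cast h3.symm

theorem classCard_add_mul_pow {p e : ℕ} [Fact p.Prime] {A : Finset ℕ}
    (h : cyclotomic (p ^ (e + 1)) ℤ ∣ ∑ a ∈ A, X ^ a) (r : ℤ) (i : ℕ) :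
    classCard p A (e + 1) (r + i * p ^ e) = classCard p A (e + 1) r := by
  induction i with
  | zero => simp
  | succ i ih =>
    rw [← ih, ← classCard_add_pow h (r + i * p ^ e)]
    push_cast
    congr 1
    ring

theorem intCast_eq_add_mul_pow {p : ℕ} (hp : p.Prime) (e : ℕ) {a r : ℤ}
    (h : (a : ZMod (p ^ e)) = r) :
    ∃ i < p, (a : ZMod (p ^ (e + 1))) = ((r + (i : ℕ) * p ^ e : ℤ) : ZMod (p ^ (e + 1))) := by
  have hp0 : (p : ℤ) ≠ 0 := by exact_mod_cast hp.ne_zero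
  rw [ZMod.intCast_eq_intCast_iff_dvd_sub] at h
  obtain ⟨t, ht⟩ := h
  -- As `r - a = p ^ e * t`, the digit that takes `r` to `a` is `-t` modulo `p`.
  refine ⟨((-t) % p).toNat, ?_, ?_⟩
  · have := Int.emod_lt_of_pos (-t) (by exact_mod_cast hp.pos : (0 : ℤ) < p)
    have := Int.emod_nonneg (-t) hp0
    omega
  · rw [ZMod.intCast_eq_intCast_iff_dvd_sub, Int.toNat_of_nonneg (Int.emod_nonneg _ hp0)]
    refine ⟨-(-t / p), ?_⟩
    have := Int.mul_ediv_add_emod (-t) p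
    push_cast at ht ⊢
    rw [pow_succ]
    linear_combination ht + (p : ℤ) ^ e * this

theorem intCast_pow_of_succ {p e : ℕ} {a r : ℤ} (h : (a : ZMod (p ^ (e + 1))) = r) :
    (a : ZMod (p ^ e)) = r := by
  rw [ZMod.intCast_eq_intCast_iff_dvd_sub] at h ⊢
  exact dvd_trans (by exact_mod_cast pow_dvd_pow p e.le_succ) h

theorem classCard_succ_le (p : ℕ) (A : Finset ℕ) (e : ℕ) (r : ℤ) :
    classCard p A (e + 1) r ≤ classCard p A e r := by
  refine Finset.card_le_card fun a ha => ?_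
  rw [Finset.mem_filter] at ha ⊢
  refine ⟨ha.1, ?_⟩
  have := intCast_pow_of_succ (p := p) (e := e) (a := (a : ℤ)) (r := r) (by simpa using ha.2)
  simpa using this

theorem classCard_congr {p : ℕ} {A : Finset ℕ} {e : ℕ} {r s : ℤ} (h : (r : ZMod (p ^ e)) = s) :
    classCard p A e r = classCard p A e s := by
  simp [classCard, h]

theorem classCard_ne_zero {p : ℕ} {A : Finset ℕ} {e : ℕ} {r : ℤ} :
    classCard p A e r ≠ 0 ↔ ∃ a ∈ A, (a : ZMod (p ^ e)) = r := by
  rw [classCard, Finset.card_ne_zero, Finset.filter_nonempty_iff]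

theorem classCard_eq_mul {p e : ℕ} [hp : Fact p.Prime] {A : Finset ℕ}
    (h : cyclotomic (p ^ (e + 1)) ℤ ∣ ∑ a ∈ A, X ^ a) (r : ℤ) :
    classCard p A e r = p * classCard p A (e + 1) r := by
  have h1 : (A.filter fun a : ℕ => (a : ZMod (p ^ e)) = (r : ZMod (p ^ e))) =
      (Finset.range p).biUnion fun i => A.filter fun a : ℕ =>
        (a : ZMod (p ^ (e + 1))) = ((r + (i : ℕ) * p ^ e : ℤ) : ZMod (p ^ (e + 1))) := by
    ext a
    simp only [Finset.mem_filter, Finset.mem_biUnion, Finset.mem_range]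
    constructor
    · rintro ⟨ha, hr⟩
      obtain ⟨i, hi, h⟩ := intCast_eq_add_mul_pow hp.out e (a := (a : ℤ)) (r := r) (by simpa using hr)
      exact ⟨i, hi, ha, by simpa using h⟩
    · rintro ⟨i, -, ha, h⟩
      refine ⟨ha, ?_⟩
      have := intCast_pow_of_succ (p := p) (e := e) (a := (a : ℤ))
        (r := r + (i : ℕ) * p ^ e) (by simpa using h)
      have h0 : ((p : ZMod (p ^ e)) ^ e) = 0 := by exact_mod_cast ZMod.natCast_self (p ^ e)
      simpa [h0] using this
  rw [classCard, h1, Finset.card_biUnion]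
  · refine (Finset.sum_congr rfl fun i _ => classCard_add_mul_pow h r i).trans ?_
    simp
  · intro i hi j hj hij
    rw [Function.onFun, Finset.disjoint_left]
    intro a ha hb
    apply hij
    have := (Finset.mem_filter.1 ha).2.symm.trans (Finset.mem_filter.1 hb).2
    rw [ZMod.intCast_eq_intCast_iff_dvd_sub] at this
    have h2 : ((p : ℤ) ^ e) * p ∣ (p : ℤ) ^ e * ((j : ℤ) - i) := by
      convert this using 1
      · push_cast; ring
      · ring
    have hp0 : (p : ℤ) ≠ 0 := by exact_mod_cast hp.out.ne_zero
    have h3 := (mul_dvd_mul_iff_left (pow_ne_zero e hp0)).1 h2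
    have h4 := Int.eq_zero_of_abs_lt_dvd h3 (by
      rw [abs_lt]
      have := Finset.mem_range.1 hi
      have := Finset.mem_range.1 hj
      constructor <;> omega)
    omega

/-! ### The tree of residues modulo powers of `p` -/

section Tree

variable {p : ℕ} [hp : Fact p.Prime] {A : Finset ℕ} {N : ℕ} {E : Finset ℕ}

/-- Descending from level `N`: each level in `E` multiplies the count by `p`, and elsewhere a class
contains a nonempty subclass. -/
theorem pow_card_le_classCard
    (hE : ∀ e, e + 1 ∈ E → cyclotomic (p ^ (e + 1)) ℤ ∣ ∑ a ∈ A, X ^ a) {e : ℕ} (he : e ≤ N) :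
    ∀ r : ℤ, classCard p A e r ≠ 0 → p ^ (E ∩ Finset.Ioc e N).card ≤ classCard p A e r := by
  induction he using Nat.decreasingInduction with
  | self =>
    intro r hr
    simpa using Nat.one_le_iff_ne_zero.2 hr
  | of_succ e he ih =>
    intro r hr
    have hI : Finset.Ioc e N = insert (e + 1) (Finset.Ioc (e + 1) N) := by
      ext; simp; omega
    by_cases h : e + 1 ∈ E
    · rw [hI, Finset.inter_insert_of_mem h, Finset.card_insert_of_notMem (by simp), pow_succ']
      rw [classCard_eq_mul (hE e h)] at hr ⊢
      exact Nat.mul_le_mul_left _ (ih r (right_ne_zero_of_mul hr))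
    · rw [hI, Finset.inter_insert_of_notMem h]
      obtain ⟨a, ha, har⟩ := classCard_ne_zero.1 hr
      have h1 : classCard p A (e + 1) a ≠ 0 := classCard_ne_zero.2 ⟨a, ha, by simp⟩
      have h2 : classCard p A e r = classCard p A e a := classCard_congr (by simp [har])
      rw [h2]
      exact (ih a h1).trans (classCard_succ_le p A e a)

/-- The total count attains the lower bound at level 0, so equality propagates upward to every
nonempty class. -/
theorem classCard_eq_pow_card
    (hE : ∀ e, e + 1 ∈ E → cyclotomic (p ^ (e + 1)) ℤ ∣ ∑ a ∈ A, X ^ a)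
    (hA : A.card = p ^ (E ∩ Finset.Ioc 0 N).card) :
    ∀ e ≤ N, ∀ r : ℤ, classCard p A e r ≠ 0 →
      classCard p A e r = p ^ (E ∩ Finset.Ioc e N).card := by
  intro e
  induction e with
  | zero =>
    intro he r hr
    rw [← hA, classCard, Finset.filter_true_of_mem]
    intro a _
    exact Subsingleton.elim (α := ZMod 1) _ _
  | succ e ih =>
    intro he r hr
    have hr' : classCard p A e r ≠ 0 := by
      have := classCard_succ_le p A e r
      omega
    have h0 := ih (by omega) r hr'
    have hI : Finset.Ioc e N = insert (e + 1) (Finset.Ioc (e + 1) N) := by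
      ext; simp; omega
    by_cases h : e + 1 ∈ E
    · rw [hI, Finset.inter_insert_of_mem h, Finset.card_insert_of_notMem (by simp), pow_succ',
        classCard_eq_mul (hE e h)] at h0
      exact Nat.eq_of_mul_eq_mul_left hp.out.pos h0
    · rw [hI, Finset.inter_insert_of_notMem h] at h0
      exact le_antisymm ((classCard_succ_le p A e r).trans h0.le) (pow_card_le_classCard hE he r hr)

theorem exists_mem_of_mem
    (hE : ∀ e, e + 1 ∈ E → cyclotomic (p ^ (e + 1)) ℤ ∣ ∑ a ∈ A, X ^ a)
    {e : ℕ} (he : e + 1 ∈ E) {a : ℕ} (ha : a ∈ A) {r : ℤ} (h : (r : ZMod (p ^ e)) = a) :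
    ∃ b ∈ A, (b : ZMod (p ^ (e + 1))) = r := by
  rw [← classCard_ne_zero]
  have h1 : classCard p A e r ≠ 0 := classCard_ne_zero.2 ⟨a, ha, h.symm⟩
  rw [classCard_eq_mul (hE e he)] at h1
  exact right_ne_zero_of_mul h1

theorem cast_succ_eq_of_notMem
    (hE : ∀ e, e + 1 ∈ E → cyclotomic (p ^ (e + 1)) ℤ ∣ ∑ a ∈ A, X ^ a)
    (hA : A.card = p ^ (E ∩ Finset.Ioc 0 N).card) {e : ℕ} (he : e + 1 ∉ E) (heN : e + 1 ≤ N)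
    {a b : ℕ} (ha : a ∈ A) (hb : b ∈ A) (h : (a : ZMod (p ^ e)) = b) :
    (a : ZMod (p ^ (e + 1))) = b := by
  have h1 : ∀ f, classCard p A f b ≠ 0 := fun f => classCard_ne_zero.2 ⟨b, hb, by simp⟩
  have hI : Finset.Ioc e N = insert (e + 1) (Finset.Ioc (e + 1) N) := by
    ext; simp; omega
  have h2 := classCard_eq_pow_card hE hA e (by omega) b (h1 e)
  rw [hI, Finset.inter_insert_of_notMem he, ← classCard_eq_pow_card hE hA (e + 1) heN b (h1 _)] at h2
  have h3 := Finset.eq_of_subset_of_card_le (fun c hc => ?_) h2.le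
  · have : a ∈ A.filter fun c : ℕ => (c : ZMod (p ^ e)) = ((b : ℤ) : ZMod (p ^ e)) :=
      Finset.mem_filter.2 ⟨ha, by simpa using h⟩
    rw [← h3] at this
    simpa using (Finset.mem_filter.1 this).2
  · rw [Finset.mem_filter] at hc ⊢
    refine ⟨hc.1, ?_⟩
    have := intCast_pow_of_succ (p := p) (e := e) (a := (c : ℤ)) (r := b) (by simpa using hc.2)
    simpa using this

theorem eq_of_cast_eq
    (hE : ∀ e, e + 1 ∈ E → cyclotomic (p ^ (e + 1)) ℤ ∣ ∑ a ∈ A, X ^ a)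
    (hA : A.card = p ^ (E ∩ Finset.Ioc 0 N).card)
    {a b : ℕ} (ha : a ∈ A) (hb : b ∈ A) (h : (a : ZMod (p ^ N)) = b) : a = b := by
  have h2 := classCard_eq_pow_card hE hA N le_rfl b (classCard_ne_zero.2 ⟨b, hb, by simp⟩)
  simp only [Finset.Ioc_self, Finset.inter_empty, Finset.card_empty, pow_zero] at h2
  exact Finset.card_le_one.1 h2.le a (Finset.mem_filter.2 ⟨ha, by simpa using h⟩) b
    (Finset.mem_filter.2 ⟨hb, by simp⟩)

end Tree

/-! ### Cyclotomic factors of the mask polynomials of a tiling -/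

section Cyclotomic

theorem prod_cyclotomic_dvd {p : ℕ} (hp : p.Prime) {E : Finset ℕ} {P : ℤ[X]}
    (hE : ∀ e ∈ E, cyclotomic (p ^ e) ℤ ∣ P) : ∏ e ∈ E, cyclotomic (p ^ e) ℤ ∣ P := by
  refine Finset.prod_dvd_of_isRelPrime (fun a _ b _ hab => ?_) hE
  have ha := cyclotomic.irreducible (pow_pos hp.pos a)
  have hb := cyclotomic.irreducible (pow_pos hp.pos b)
  refine (ha.isRelPrime_iff_not_dvd).2 fun hd => hab ?_
  have := eq_of_monic_of_associated (cyclotomic.monic _ ℤ) (cyclotomic.monic _ ℤ)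
    (ha.associated_of_dvd hb hd)
  exact Nat.pow_right_injective hp.two_le (cyclotomic_injective this)

theorem pow_card_dvd_eval_one {p : ℕ} (hp : p.Prime) {E : Finset ℕ} {P : ℤ[X]} (h0 : 0 ∉ E)
    (hE : ∀ e ∈ E, cyclotomic (p ^ e) ℤ ∣ P) : (p : ℤ) ^ E.card ∣ P.eval 1 := by
  have := Fact.mk hp
  have h := map_dvd (evalRingHom (1 : ℤ)) (prod_cyclotomic_dvd hp hE)
  rw [map_prod, Finset.prod_congr rfl (g := fun _ => (p : ℤ)), Finset.prod_const] at h
  · simpa using h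
  · intro e he
    obtain ⟨k, rfl⟩ := Nat.exists_eq_succ_of_ne_zero (fun h => h0 (h ▸ he))
    simp [eval_one_cyclotomic_prime_pow]

variable {n : ℕ} [NeZero n]

theorem pow_val_add {ζ : ℂ} (hζ : ζ ^ n = 1) (a b : ZMod n) :
    ζ ^ (a + b).val = ζ ^ a.val * ζ ^ b.val := by
  rw [ZMod.val_add, ← pow_add, ← pow_eq_pow_mod _ hζ]

theorem sum_pow_val {ζ : ℂ} (hζ : ζ ^ n = 1) (h1 : ζ ≠ 1) : ∑ z : ZMod n, ζ ^ z.val = 0 := by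
  have h : ∑ i ∈ Finset.range n, ζ ^ i = 0 := by
    rw [geom_sum_eq h1, hζ, sub_self, zero_div]
  rw [← h]
  refine Finset.sum_bij (fun z _ => z.val) (fun z _ => Finset.mem_range.2 z.val_lt)
    (fun a _ b _ h => ZMod.val_injective n h) (fun i hi => ?_) (fun _ _ => rfl)
  exact ⟨i, Finset.mem_univ _, ZMod.val_cast_of_lt (Finset.mem_range.1 hi)⟩

variable {A B : Finset (ZMod n)}

/-- A nontrivial character of order `p ^ e` sums to zero over `ℤ/n`, and this sum factors over `A`
and `B`. -/
theorem cyclotomic_dvd_or_dvd {p e : ℕ} (hp : p.Prime) (he : e ≠ 0) (hn : p ^ e ∣ n)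
    (hAB : ∀ f : ZMod n → ℂ, ∑ a ∈ A, ∑ b ∈ B, f (a + b) = ∑ z, f z) :
    cyclotomic (p ^ e) ℤ ∣ ∑ a ∈ A.image ZMod.val, X ^ a ∨
      cyclotomic (p ^ e) ℤ ∣ ∑ a ∈ B.image ZMod.val, X ^ a := by
  have hpe : p ^ e ≠ 0 := pow_ne_zero _ hp.ne_zero
  have hζ := Complex.isPrimitiveRoot_exp (p ^ e) hpe
  set ζ := Complex.exp (2 * Real.pi * Complex.I / ((p ^ e : ℕ) : ℂ)) with hdef
  have hζn : ζ ^ n = 1 := (hζ.pow_eq_one_iff_dvd n).2 hn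
  have hζ1 : ζ ≠ 1 := hζ.ne_one (Nat.one_lt_pow he hp.one_lt)
  have h := hAB fun z => ζ ^ z.val
  rw [sum_pow_val hζn hζ1] at h
  simp only [pow_val_add hζn, ← Finset.mul_sum, ← Finset.sum_mul] at h
  have key : ∀ C : Finset (ZMod n), ∑ a ∈ C, ζ ^ a.val = 0 →
      cyclotomic (p ^ e) ℤ ∣ ∑ a ∈ C.image ZMod.val, X ^ a := by
    intro C hC
    rw [cyclotomic_eq_minpoly hζ (Nat.pos_of_ne_zero hpe)]
    refine minpoly.isIntegrallyClosed_dvd (hζ.isIntegral (Nat.pos_of_ne_zero hpe)) ?_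
    rw [Finset.sum_image fun a _ b _ h => ZMod.val_injective n h]
    simpa using hC
  exact (mul_eq_zero.1 h).imp (key A) (key B)

theorem exists_cyclotomic_exponents {p ℓ N u : ℕ} (hp : p.Prime) (hn : n = p ^ N * u)
    (hu : ¬ p ∣ u) (hA : A.card = p ^ ℓ)
    (hAB : ∀ f : ZMod n → ℂ, ∑ a ∈ A, ∑ b ∈ B, f (a + b) = ∑ z, f z) :
    ∃ E ⊆ Finset.Ioc 0 N, E.card = ℓ ∧
      ∀ e ∈ E, cyclotomic (p ^ e) ℤ ∣ ∑ a ∈ A.image ZMod.val, X ^ a := by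
  classical
  have heval : ∀ C : Finset (ZMod n), (∑ a ∈ C.image ZMod.val, X ^ a : ℤ[X]).eval 1 = C.card := by
    intro C
    rw [Finset.sum_image fun a _ b _ h => ZMod.val_injective n h]
    simp [eval_finsetSum]
  have hcard : A.card * B.card = n := by
    have := hAB fun _ => 1
    simp only [Finset.sum_const, Finset.card_univ, ZMod.card, nsmul_eq_mul, mul_one] at this
    exact_mod_cast this
  let P : ℕ → Prop := fun e => cyclotomic (p ^ e) ℤ ∣ ∑ a ∈ A.image ZMod.val, X ^ a
  refine ⟨(Finset.Ioc 0 N).filter P, Finset.filter_subset _ _, ?_,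
    fun e he => (Finset.mem_filter.1 he).2⟩
  have h1 := pow_card_dvd_eval_one (E := (Finset.Ioc 0 N).filter P) hp (by simp)
    fun e he => (Finset.mem_filter.1 he).2
  have h2 := pow_card_dvd_eval_one (E := (Finset.Ioc 0 N).filter fun e => ¬ P e)
    (P := ∑ a ∈ B.image ZMod.val, X ^ a) hp (by simp) fun e he => by
      have he' := Finset.mem_filter.1 he
      have he1 := Finset.mem_Ioc.1 he'.1
      exact (cyclotomic_dvd_or_dvd hp he1.1.ne' (hn ▸ (pow_dvd_pow p he1.2).mul_right u)
        hAB).resolve_left he'.2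
  rw [heval] at h1 h2
  norm_cast at h1 h2
  rw [hA, Nat.pow_dvd_pow_iff_le_right hp.one_lt] at h1
  -- `h1` bounds the exponents of `A` by `ℓ`; comparing powers of `p` in `|A| * |B| = n` bounds the
  -- rest by `N - ℓ`, so both bounds are sharp.
  have h3 : p ^ (ℓ + ((Finset.Ioc 0 N).filter fun e => ¬ P e).card) ∣ p ^ N * u := by
    rw [← hn, ← hcard, hA, pow_add]
    exact mul_dvd_mul_left _ h2
  have h4 := (Nat.pow_dvd_pow_iff_le_right hp.one_lt).1
    (((Nat.Coprime.pow_left _ ((hp.coprime_iff_not_dvd).2 hu))).dvd_of_dvd_mul_right h3)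
  have h5 := Finset.card_filter_add_card_filter_not (s := Finset.Ioc 0 N) P
  rw [Nat.card_Ioc] at h5
  omega

end Cyclotomic
end PerfectCirculant

namespace PerfectCirculant

/-! ### Perfect codes as tilings; connectedness of quotients -/

section Graph

variable {G H : Type*} [AddGroup G] [AddGroup H]

theorem IsConnectionSet.adj_iff {S : Set G} (hS : IsConnectionSet S) {x y : G} :
    (SimpleGraph.circulantGraph S).Adj x y ↔ x - y ∈ S := by
  rw [SimpleGraph.circulantGraph, SimpleGraph.fromRel_adj]
  constructor
  · rintro ⟨-, h | h⟩
    · exact h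
    · simpa using hS.2 _ h
  · refine fun h => ⟨?_, Or.inl h⟩
    rintro rfl
    exact hS.1 (by simpa using h)

theorem IsConnectionSet.neg_mem_extSet {S : Set G} (hS : IsConnectionSet S) {x : G}
    (hx : x ∈ extSet S) : -x ∈ extSet S := by
  rcases hx with rfl | hx
  · exact Or.inl neg_zero
  · exact Or.inr (hS.2 x hx)

theorem isPerfectCode_circulantGraph_iff {S : Set G} (hS : IsConnectionSet S) {D : Set G} :
    IsPerfectCode (SimpleGraph.circulantGraph S) D ↔ ∀ z, ∃! d, d ∈ D ∧ z - d ∈ extSet S := by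
  constructor
  · rintro ⟨hI, hD⟩ z
    by_cases hz : z ∈ D
    · refine ⟨z, ⟨hz, Or.inl (sub_self z)⟩, ?_⟩
      rintro d ⟨hd, h | h⟩
      · exact (sub_eq_zero.1 h).symm
      · by_contra hne
        exact hI hz hd (Ne.symm hne) (hS.adj_iff.2 h)
    · obtain ⟨d, ⟨hd, hadj⟩, hu⟩ := hD z hz
      refine ⟨d, ⟨hd, Or.inr (hS.adj_iff.1 hadj)⟩, ?_⟩
      rintro d' ⟨hd', h | h⟩
      · exact absurd (sub_eq_zero.1 h ▸ hd') hz
      · exact hu d' ⟨hd', hS.adj_iff.2 h⟩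
  · intro h
    refine ⟨fun x hx y hy hne hadj => hne ?_, fun z hz => ?_⟩
    · exact (h x).unique ⟨hx, Or.inl (sub_self x)⟩ ⟨hy, Or.inr (hS.adj_iff.1 hadj)⟩
    · obtain ⟨d, ⟨hd, hzd⟩, hu⟩ := h z
      refine ⟨d, ⟨hd, ?_⟩, fun d' hd' => hu d' ⟨hd'.1, Or.inr (hS.adj_iff.1 hd'.2)⟩⟩
      rcases hzd with h | h
      · exact absurd (sub_eq_zero.1 h ▸ hd) hz
      · exact hS.adj_iff.2 h

theorem IsPerfectCode.map_iso {V W : Type*} {Γ : SimpleGraph V} {Λ : SimpleGraph W} (f : Γ ≃g Λ)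
    {D : Set V} (hD : IsPerfectCode Γ D) : IsPerfectCode Λ (f.symm ⁻¹' D) := by
  refine ⟨fun x hx y hy hne hadj => ?_, fun v hv => ?_⟩
  · exact hD.1 hx hy (fun h => hne (f.symm.injective h)) (f.symm.map_adj_iff.2 hadj)
  · obtain ⟨d, ⟨hd, hadj⟩, hu⟩ := hD.2 (f.symm v) hv
    refine ⟨f d, ⟨by simpa using hd, ?_⟩, fun d' hd' => ?_⟩
    · rw [← f.symm.map_adj_iff]
      simpa using hadj
    · rw [← hu (f.symm d') ⟨hd'.1, f.symm.map_adj_iff.2 hd'.2⟩]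
      simp

theorem connected_circulantGraph_of_surjective {S : Set G} {T : Set H} (hS : IsConnectionSet S)
    (hT : IsConnectionSet T) (f : G →+ H) (hf : Function.Surjective f)
    (hST : ∀ s ∈ S, f s ∈ extSet T) (h : (SimpleGraph.circulantGraph S).Connected) :
    (SimpleGraph.circulantGraph T).Connected := by
  have key : ∀ x y : G, (SimpleGraph.circulantGraph S).Walk x y →
      (SimpleGraph.circulantGraph T).Reachable (f x) (f y) := by
    intro x y w
    induction w with
    | nil => exact SimpleGraph.Reachable.refl _
    | cons hadj _ ih =>
      refine SimpleGraph.Reachable.trans ?_ ih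
      have h1 := hST _ (hS.adj_iff.1 hadj)
      rw [map_sub] at h1
      rcases h1 with h1 | h1
      · rw [sub_eq_zero.1 h1]
      · exact (hT.adj_iff.2 h1).reachable
  have : Nonempty H := ⟨0⟩
  refine SimpleGraph.Connected.mk fun x y => ?_
  obtain ⟨x, rfl⟩ := hf x
  obtain ⟨y, rfl⟩ := hf y
  exact key x y (h.preconnected x y).some

end Graph

/-! ### Lifting tilings through `fbar` and `gbar` -/

section Lift

variable {m n : ℕ}

/-- The reduction map from `ℤ/(mn)` to `ℤ/n`. -/
abbrev red (m n : ℕ) : ZMod (m * n) →+* ZMod n := ZMod.castHom (dvd_mul_left n m) (ZMod n)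

theorem red_natCast_add_mul (s : ZMod n) [NeZero n] (i : ℕ) :
    red m n ((s.val + i * n : ℕ) : ZMod (m * n)) = s := by
  rw [map_natCast]
  simp

theorem eq_natCast_red_val_add [NeZero m] [NeZero n] (x : ZMod (m * n)) :
    x = (((red m n x).val + x.val / n * n : ℕ) : ZMod (m * n)) := by
  have h : (red m n x).val = x.val % n := by
    conv_lhs => rw [← ZMod.natCast_zmod_val x, map_natCast]
    exact ZMod.val_natCast n _
  rw [h, Nat.mod_add_div', ZMod.natCast_zmod_val]

/-- Eliminates `σ`: membership means that reduction modulo `n` maps `T` bijectively onto `S`. -/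
theorem mem_fbar_iff [NeZero m] [NeZero n] {S : Set (ZMod n)} (h0 : (0 : ZMod n) ∉ S)
    {T : Set (ZMod (m * n))} :
    T ∈ fbar m S ↔ IsConnectionSet T ∧ (∀ x ∈ T, red m n x ∈ S) ∧
      ∀ s ∈ S, ∃! x, x ∈ T ∧ red m n x = s := by
  classical
  constructor
  · rintro ⟨σ, ⟨-, -, hneg⟩, rfl⟩
    have hmem : ∀ x ∈ liftSet m S σ, red m n x ∈ S ∧
        x = (((red m n x).val + σ (red m n x) * n : ℕ) : ZMod (m * n)) := by
      rintro x ⟨s, hs, rfl⟩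
      rw [red_natCast_add_mul]
      exact ⟨hs, rfl⟩
    refine ⟨⟨fun h => h0 ?_, hneg⟩, fun x hx => (hmem x hx).1, fun s hs => ?_⟩
    · simpa using (hmem 0 h).1
    · refine ⟨_, ⟨⟨s, hs, rfl⟩, red_natCast_add_mul s _⟩, ?_⟩
      rintro x ⟨hx, rfl⟩
      exact (hmem x hx).2
  · rintro ⟨hT, hTS, hST⟩
    choose! g hg hu using hST
    let σ : ZMod n → ℕ := fun s => if s ∈ S then (g s).val / n else 0
    have hσ : T = liftSet m S σ := by
      ext x
      constructor
      · intro hx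
        refine ⟨red m n x, hTS x hx, ?_⟩
        have : g (red m n x) = x := (hu _ (hTS x hx) x ⟨hx, rfl⟩).symm
        simp only [σ, if_pos (hTS x hx), this]
        exact eq_natCast_red_val_add x
      · rintro ⟨s, hs, rfl⟩
        have h := eq_natCast_red_val_add (g s)
        rw [(hg s hs).2] at h
        simp only [σ, if_pos hs]
        rw [← h]
        exact (hg s hs).1
    refine ⟨σ, ⟨fun s _ => ?_, if_neg h0, ?_⟩, hσ⟩
    · simp only [σ]
      split_ifs
      · rw [Nat.div_lt_iff_lt_mul (NeZero.pos n)]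
        exact (g s).val_lt
      · exact NeZero.pos m
    · rw [← hσ]
      exact hT.2

theorem mem_gbar_iff [NeZero m] [NeZero n] {S : Set (ZMod n)} {x : ZMod (m * n)} :
    x ∈ gbar m S ↔ x ≠ 0 ∧ red m n x ∈ extSet S := by
  constructor
  · rintro ⟨⟨s, hs, i, -, rfl⟩, hx⟩
    rw [red_natCast_add_mul]
    exact ⟨hx, hs⟩
  · rintro ⟨hx, hs⟩
    refine ⟨⟨_, hs, x.val / n, ?_, eq_natCast_red_val_add x⟩, hx⟩
    rw [Nat.div_lt_iff_lt_mul (NeZero.pos n)]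
    exact x.val_lt

theorem mem_extSet_gbar_iff [NeZero m] [NeZero n] {S : Set (ZMod n)} {x : ZMod (m * n)} :
    x ∈ extSet (gbar m S) ↔ red m n x ∈ extSet S := by
  by_cases hx : x = 0
  · subst hx
    simp [extSet]
  · rw [extSet, Set.mem_insert_iff, mem_gbar_iff]
    simp [hx]

/-- Every element of `G` is uniquely the sum of an element of `D` and an element of `S ∪ {0}`. -/
def Tiles {G : Type*} [AddGroup G] (S D : Set G) : Prop :=
  ∀ z, ∃! d, d ∈ D ∧ z - d ∈ extSet S

theorem Tiles.fbar [NeZero m] [NeZero n] {S D : Set (ZMod n)} (h0 : (0 : ZMod n) ∉ S)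
    (hD : Tiles S D) {T : Set (ZMod (m * n))} (hT : T ∈ fbar m S) :
    Tiles T (red m n ⁻¹' D) := by
  obtain ⟨-, hTS, hST⟩ := (mem_fbar_iff h0).1 hT
  have hext : ∀ s ∈ extSet S, ∃! x, x ∈ extSet T ∧ red m n x = s := by
    rintro s (rfl | hs)
    · refine ⟨0, ⟨Or.inl rfl, map_zero _⟩, ?_⟩
      rintro x ⟨rfl | hx, h⟩
      · rfl
      · exact absurd (h ▸ hTS x hx) h0
    · obtain ⟨x, hx, hu⟩ := hST s hs
      refine ⟨x, ⟨Or.inr hx.1, hx.2⟩, ?_⟩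
      rintro y ⟨rfl | hy, h⟩
      · rw [map_zero] at h
        exact absurd (h ▸ hs) h0
      · exact hu y ⟨hy, h⟩
  intro z
  obtain ⟨d, ⟨hd, hzd⟩, hu⟩ := hD (red m n z)
  obtain ⟨x, ⟨hx, hxz⟩, hux⟩ := hext _ hzd
  refine ⟨z - x, ⟨?_, by simpa using hx⟩, ?_⟩
  · rw [Set.mem_preimage, map_sub, hxz]
    simpa using hd
  · rintro d' ⟨hd', hz⟩
    have h1 : red m n (z - d') ∈ extSet S := by
      rcases hz with h | h
      · exact Or.inl (by rw [h, map_zero])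
      · exact Or.inr (hTS _ h)
    have h2 := hu (red m n d') ⟨hd', by rwa [← map_sub]⟩
    rw [← hux (z - d') ⟨hz, by rw [map_sub, h2]⟩, sub_sub_cancel]

theorem Tiles.gbar [NeZero m] [NeZero n] {S D : Set (ZMod n)} (hD : Tiles S D) :
    Tiles (gbar m S) ((fun d : ZMod n => ((d.val : ℕ) : ZMod (m * n))) '' D) := by
  have hr : ∀ d : ZMod n, red m n ((d.val : ℕ) : ZMod (m * n)) = d := fun d => by
    simp
  intro z
  obtain ⟨d, ⟨hd, hzd⟩, hu⟩ := hD (red m n z)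
  refine ⟨_, ⟨⟨d, hd, rfl⟩, ?_⟩, ?_⟩
  · rwa [mem_extSet_gbar_iff, map_sub, hr]
  · rintro _ ⟨⟨d', hd', rfl⟩, h⟩
    rw [mem_extSet_gbar_iff, map_sub, hr] at h
    rw [hu d' ⟨hd', h⟩]

theorem IsLift.exists_tiles {p : ℕ} {l k : List ℕ} {n : ℕ} {T : Set (ZMod n)}
    (h : IsLift p l k n T) (hn : n ≠ 0) : IsConnectionSet T ∧ ∃ D, Tiles T D := by
  induction h with
  | base r m T hT hc =>
    have : NeZero m := ⟨left_ne_zero_of_mul hn⟩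
    have : NeZero (p ^ r) := ⟨right_ne_zero_of_mul hn⟩
    have h0 : (0 : ZMod (p ^ r)) ∉ ({0}ᶜ : Set (ZMod (p ^ r))) := by simp
    refine ⟨((mem_fbar_iff h0).1 hT).1, _, Tiles.fbar h0 (D := {0}) (fun z => ?_) hT⟩
    refine ⟨0, ⟨rfl, ?_⟩, fun d hd => hd.1⟩
    by_cases hz : z = 0
    · exact Or.inl (by simp [hz])
    · exact Or.inr (by simpa using hz)
  | step a m l k n S hS T hT hc ih =>
    have : NeZero m := ⟨left_ne_zero_of_mul hn⟩
    have hn' := right_ne_zero_of_mul hn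
    have : NeZero (p ^ a) := ⟨left_ne_zero_of_mul hn'⟩
    have : NeZero n := ⟨right_ne_zero_of_mul hn'⟩
    obtain ⟨-, D, hD⟩ := ih (NeZero.ne n)
    have h0 : (0 : ZMod (p ^ a * n)) ∉ PerfectCirculant.gbar (p ^ a) S := fun h => h.2 rfl
    exact ⟨((mem_fbar_iff h0).1 hT).1, _, Tiles.fbar h0 hD.gbar hT⟩

end Lift

/-! ### Rebuilding the layers from residues -/

section Reduction

/-- The nonzero residues modulo `M` of a set of integers. -/
def residues (A : Set ℤ) (M : ℕ) : Set (ZMod M) := {x | x ≠ 0 ∧ ∃ z ∈ A, (z : ZMod M) = x}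

theorem isConnectionSet_residues {A : Set ℤ} (hA : ∀ z ∈ A, -z ∈ A) (M : ℕ) :
    IsConnectionSet (residues A M) := by
  refine ⟨fun h => h.1 rfl, ?_⟩
  rintro x ⟨hx, z, hz, rfl⟩
  exact ⟨neg_ne_zero.2 hx, -z, hA z hz, by simp⟩

theorem mem_extSet_residues {A : Set ℤ} (h0 : (0 : ℤ) ∈ A) {M : ℕ} {x : ZMod M} :
    x ∈ extSet (residues A M) ↔ ∃ z ∈ A, (z : ZMod M) = x := by
  by_cases hx : x = 0
  · subst hx
    exact iff_of_true (Or.inl rfl) ⟨0, h0, by simp⟩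
  · simp [extSet, residues, hx]

theorem residues_mem_fbar {A : Set ℤ} (hA : ∀ z ∈ A, -z ∈ A) (h0 : (0 : ℤ) ∈ A) {m n : ℕ}
    [NeZero m] [NeZero n] {S : Set (ZMod n)} (h0S : (0 : ZMod n) ∉ S)
    (hS : ∀ x, x ∈ extSet S ↔ ∃ z ∈ A, (z : ZMod n) = x)
    (hinj : ∀ z ∈ A, ∀ w ∈ A, (z : ZMod n) = w → (z : ZMod (m * n)) = w) :
    residues A (m * n) ∈ fbar m S := by
  have hne : ∀ x : ZMod n, x ≠ 0 → x ∈ extSet S → x ∈ S := fun x hx h => h.resolve_left hx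
  refine (mem_fbar_iff h0S).2 ⟨isConnectionSet_residues hA _, ?_, ?_⟩
  · rintro _ ⟨hx, z, hz, rfl⟩
    rw [map_intCast]
    refine hne _ (fun h => hx ?_) ((hS _).2 ⟨z, hz, rfl⟩)
    simpa using hinj z hz 0 h0 (by simpa using h)
  · intro s hs
    obtain ⟨z, hz, rfl⟩ := (hS s).1 (Or.inr hs)
    refine ⟨z, ⟨⟨fun h => h0S ?_, z, hz, rfl⟩, map_intCast _ _⟩, ?_⟩
    · have := congrArg (red m n) h
      rw [map_intCast, map_zero] at this
      rwa [this] at hs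
    · rintro _ ⟨⟨-, w, hw, rfl⟩, h⟩
      rw [map_intCast] at h
      exact hinj w hw z hz h

/-- Letting `M` exceed `p ^ e` lets consecutive rigid levels accumulate until a splitting level is
reached; `M / p ^ e` then becomes the parameter of a single `f̄`. -/
theorem exists_isLift_residues {p n N : ℕ} (hp : p.Prime) (hn : n ≠ 0) {A : Set ℤ} {E : Finset ℕ}
    (hA : ∀ z ∈ A, -z ∈ A) (h0 : (0 : ℤ) ∈ A)
    (hconn : ∀ M, M ∣ n → (SimpleGraph.circulantGraph (residues A M)).Connected)
    (hfull : ∀ e, e + 1 ∈ E → ∀ z ∈ A, ∀ r : ℤ, (r : ZMod (p ^ e)) = z →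
      ∃ w ∈ A, (w : ZMod (p ^ (e + 1))) = r)
    (hinj : ∀ e, e + 1 ∉ E → e + 1 ≤ N → ∀ z ∈ A, ∀ w ∈ A, (z : ZMod (p ^ e)) = w →
      (z : ZMod (p ^ (e + 1))) = w)
    (h1 : 1 ∈ E) {e : ℕ} (he : 1 ≤ e) : e ≤ N → ∀ M, p ^ e ∣ M → M ∣ n →
      (∀ z ∈ A, ∀ w ∈ A, (z : ZMod (p ^ e)) = w → (z : ZMod M) = w) →
      ∃ l k : List ℕ, l.length = k.length ∧ (∀ a ∈ l, 0 < a) ∧ (∀ b ∈ k, 0 < b) ∧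
        l.sum = (E ∩ Finset.Ioc 0 e).card ∧ k.prod * p ^ l.sum = M ∧
        IsLift p l k M (residues A M) := by
  induction e, he using Nat.le_induction with
  | base =>
    rintro - M ⟨m, rfl⟩ hM hMinj
    rw [mul_comm] at hM hMinj ⊢
    have hm : NeZero m := ⟨left_ne_zero_of_mul (ne_zero_of_dvd_ne_zero hn hM)⟩
    have : NeZero (p ^ 1) := ⟨pow_ne_zero _ hp.ne_zero⟩
    have hE : E ∩ Finset.Ioc 0 1 = {1} := by
      ext x
      simp only [Finset.mem_inter, Finset.mem_Ioc, Finset.mem_singleton]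
      constructor
      · omega
      · rintro rfl
        exact ⟨h1, by omega⟩
    refine ⟨[1], [m], rfl, by simp, by simpa using NeZero.pos m, by rw [hE]; rfl, by simp, ?_⟩
    refine IsLift.base 1 m _ (residues_mem_fbar hA h0 (by simp) (fun x => ?_) hMinj) (hconn _ hM)
    refine iff_of_true ?_ ?_
    · by_cases hx : x = 0
      · exact Or.inl hx
      · exact Or.inr hx
    · obtain ⟨w, hw, h⟩ := hfull 0 h1 0 h0 (x.val : ℤ) (Subsingleton.elim (α := ZMod 1) _ _)
      exact ⟨w, hw, h.trans (by simp)⟩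
  | succ e he ih =>
    intro heN M hpM hM hMinj
    have hI : Finset.Ioc 0 (e + 1) = insert (e + 1) (Finset.Ioc 0 e) := by
      ext; simp; omega
    by_cases heE : e + 1 ∈ E
    · obtain ⟨m, rfl⟩ := hpM
      obtain ⟨l, k, hlk, hl, hk, hsum, hprod, hlift⟩ := ih (by omega) (p ^ e) dvd_rfl
        -- Below a splitting level the modulus restarts at `p ^ e`, where the injectivity condition
        -- is trivial.
        ((pow_dvd_pow p e.le_succ).trans ((dvd_mul_right _ m).trans hM)) fun z _ w _ h => h
      have hpow : p ^ (e + 1) = p ^ 1 * p ^ e := by ring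
      rw [mul_comm] at hM hMinj ⊢
      have hfull' := hfull e heE
      rw [hpow] at hM hMinj hfull' ⊢
      have hm : NeZero m := ⟨left_ne_zero_of_mul (ne_zero_of_dvd_ne_zero hn hM)⟩
      have : NeZero (p ^ 1) := ⟨pow_ne_zero _ hp.ne_zero⟩
      have : NeZero (p ^ e) := ⟨pow_ne_zero _ hp.ne_zero⟩
      refine ⟨1 :: l, m :: k, by simp [hlk], by simpa using hl,
        by simpa using ⟨NeZero.pos m, hk⟩, ?_, ?_, ?_⟩
      · rw [hI, Finset.inter_insert_of_mem heE, Finset.card_insert_of_notMem (by simp),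
          List.sum_cons, hsum, add_comm]
      · rw [← hprod]
        simp only [List.prod_cons, List.sum_cons]
        ring
      · refine IsLift.step 1 m l k (p ^ e) _ hlift _
          (residues_mem_fbar hA h0 (fun h => h.2 rfl) (fun x => ?_) hMinj) (hconn _ hM)
        rw [mem_extSet_gbar_iff, mem_extSet_residues h0]
        constructor
        · rintro ⟨z, hz, hzx⟩
          obtain ⟨w, hw, h⟩ := hfull' z hz (x.val : ℤ) (by
            rw [hzx]
            conv_rhs => rw [← ZMod.natCast_zmod_val x, map_natCast]
            simp)
          exact ⟨w, hw, h.trans (by simp)⟩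
        · rintro ⟨z, hz, rfl⟩
          exact ⟨z, hz, (map_intCast _ _).symm⟩
    · rw [hI, Finset.inter_insert_of_notMem heE]
      exact ih (by omega) M ((pow_dvd_pow p e.le_succ).trans hpM) hM
        fun z hz w hw h => hMinj z hz w hw (hinj e heE heN z hz w hw h)

end Reduction

end PerfectCirculant

/-! ### From a tiling to the iterated lift -/

namespace PerfectCirculant

theorem Tiles.sum_add {n : ℕ} [NeZero n] {S D : Set (ZMod n)} (h : Tiles S D)
    {A B : Finset (ZMod n)} (hA : ∀ x, x ∈ A ↔ x ∈ extSet S) (hB : ∀ x, x ∈ B ↔ x ∈ D)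
    (f : ZMod n → ℂ) : ∑ a ∈ A, ∑ b ∈ B, f (a + b) = ∑ z, f z := by
  rw [← Finset.sum_product']
  refine Finset.sum_bij (fun x _ => x.1 + x.2) (fun _ _ => Finset.mem_univ _) ?_ ?_
    (fun _ _ => rfl)
  · rintro ⟨a, b⟩ hab ⟨a', b'⟩ hab' heq
    rw [Finset.mem_product, hA, hB] at hab hab'
    dsimp only at hab hab' heq
    have hbb : b = b' := (h (a + b)).unique ⟨hab.2, by simpa using hab.1⟩
      ⟨hab'.2, by rw [heq]; simpa using hab'.1⟩
    subst hbb
    rw [add_right_cancel heq]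
  · intro z _
    obtain ⟨d, ⟨hd, hz⟩, -⟩ := h z
    exact ⟨(z - d, d), Finset.mem_product.2 ⟨(hA _).2 hz, (hB _).2 hd⟩, by simp⟩

theorem exists_isLift_of_tiles {p ℓ m n : ℕ} (hp : p.Prime) (hℓ : 1 ≤ ℓ) (hm : m ≠ 0)
    (hn : n = p ^ ℓ * m) {S D : Set (ZMod n)} (hS : IsConnectionSet S)
    (hconn : (SimpleGraph.circulantGraph S).Connected) (hcard : (extSet S).ncard = p ^ ℓ)
    (hD : Tiles S D) :
    ∃ l k : List ℕ, l.length = k.length ∧ (∀ a ∈ l, 0 < a) ∧ (∀ b ∈ k, 0 < b) ∧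
      l.sum = ℓ ∧ k.prod = m ∧ IsLift p l k n S := by
  classical
  have := Fact.mk hp
  have hn0 : n ≠ 0 := by rw [hn]; exact mul_ne_zero (pow_ne_zero _ hp.ne_zero) hm
  have : NeZero n := ⟨hn0⟩
  obtain ⟨N, u, hu, hN⟩ := Nat.exists_eq_pow_mul_and_not_dvd hn0 p hp.ne_one
  have hpN : ∀ e ≤ N, p ^ e ∣ n := fun e he => hN ▸ (pow_dvd_pow p he).mul_right u
  let A : Finset (ZMod n) := (extSet S).toFinset
  have hAcard : A.card = p ^ ℓ := by rw [← hcard, Set.ncard_eq_toFinset_card']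
  obtain ⟨E, hEN, hE, hcyc⟩ := exists_cyclotomic_exponents (A := A) (B := D.toFinset) hp hN hu hAcard
    (hD.sum_add (fun _ => Set.mem_toFinset) fun _ => Set.mem_toFinset)
  set A' : Finset ℕ := A.image ZMod.val with hA'
  have hA'card : A'.card = p ^ (E ∩ Finset.Ioc 0 N).card := by
    rw [Finset.inter_eq_left.2 hEN, hE, hA', Finset.card_image_of_injective _ (ZMod.val_injective n),
      hAcard]
  have hcyc' : ∀ e, e + 1 ∈ E → Polynomial.cyclotomic (p ^ (e + 1)) ℤ ∣
      ∑ a ∈ A', Polynomial.X ^ a := fun e he => hcyc _ he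
  -- The full integer preimage of `S₀` is closed under negation, unlike the representatives in `A'`.
  let Z : Set ℤ := {z | (z : ZMod n) ∈ extSet S}
  have hrep : ∀ z ∈ Z, ∃ a ∈ A', ∀ M, M ∣ n → (z : ZMod M) = (a : ZMod M) := by
    intro z hz
    refine ⟨_, Finset.mem_image_of_mem _ (Set.mem_toFinset.2 hz), fun M hM => ?_⟩
    have := congrArg (ZMod.castHom hM (ZMod M)) (ZMod.natCast_zmod_val (z : ZMod n))
    rw [map_natCast, map_intCast] at this
    exact this.symm
  have hmem : ∀ a ∈ A', (a : ℤ) ∈ Z := by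
    intro a ha
    obtain ⟨x, hx, rfl⟩ := Finset.mem_image.1 ha
    simpa [Z] using Set.mem_toFinset.1 hx
  have hneg : ∀ z ∈ Z, -z ∈ Z := by
    intro z hz
    simpa [Z] using hS.neg_mem_extSet hz
  have h0 : (0 : ℤ) ∈ Z := by simp [Z, extSet]
  have hres : residues Z n = S := by
    ext x
    constructor
    · rintro ⟨hx, z, hz, rfl⟩
      exact hz.resolve_left hx
    · intro hx
      refine ⟨fun h => hS.1 (h ▸ hx), (x.val : ℕ), hmem _ (Finset.mem_image_of_mem _ (Set.mem_toFinset.2 ?_)),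
        by simp⟩
      exact Or.inr hx
  have hconnM : ∀ M, M ∣ n → (SimpleGraph.circulantGraph (residues Z M)).Connected := by
    intro M hM
    refine connected_circulantGraph_of_surjective hS (isConnectionSet_residues hneg M)
      (ZMod.castHom hM (ZMod M)).toAddMonoidHom (ZMod.castHom_surjective hM) (fun s hs => ?_) hconn
    rw [mem_extSet_residues h0]
    refine ⟨_, hmem _ (Finset.mem_image_of_mem _ (Set.mem_toFinset.2 (Or.inr hs))), ?_⟩
    conv_rhs => rw [← ZMod.natCast_zmod_val s]
    simp
  have hinj : ∀ e, e + 1 ∉ E → e + 1 ≤ N → ∀ z ∈ Z, ∀ w ∈ Z, (z : ZMod (p ^ e)) = w →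
      (z : ZMod (p ^ (e + 1))) = w := by
    intro e he heN z hz w hw h
    obtain ⟨a, ha, haz⟩ := hrep z hz
    obtain ⟨b, hb, hbw⟩ := hrep w hw
    rw [haz _ (hpN _ heN), hbw _ (hpN _ heN)]
    refine cast_succ_eq_of_notMem hcyc' hA'card he heN ha hb ?_
    rwa [← haz _ (hpN _ (by omega)), ← hbw _ (hpN _ (by omega))]
  have hfull : ∀ e, e + 1 ∈ E → ∀ z ∈ Z, ∀ r : ℤ, (r : ZMod (p ^ e)) = z →
      ∃ w ∈ Z, (w : ZMod (p ^ (e + 1))) = r := by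
    intro e he z hz r hr
    obtain ⟨a, ha, haz⟩ := hrep z hz
    have heN := (Finset.mem_Ioc.1 (hEN he)).2
    rw [haz _ (hpN _ (by omega))] at hr
    obtain ⟨b, hb, hbr⟩ := exists_mem_of_mem hcyc' he ha hr
    exact ⟨b, hmem b hb, by simpa using hbr⟩
  have hN1 : 1 ≤ N := by
    obtain ⟨e, he⟩ := Finset.card_pos.1 (hE ▸ hℓ)
    have := Finset.mem_Ioc.1 (hEN he)
    omega
  -- Otherwise all of `S₀` is divisible by `p`, and the quotient graph on `ℤ/p` has no edges
  -- although it is connected.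
  have h1 : 1 ∈ E := by
    by_contra h1
    have hp1 : Fact (1 < p ^ 1) := ⟨by simpa using hp.one_lt⟩
    obtain ⟨y, hy⟩ : ∃ y : ZMod (p ^ 1), y ≠ 0 := ⟨1, one_ne_zero⟩
    obtain ⟨w⟩ := (hconnM (p ^ 1) (hpN 1 hN1)).preconnected 0 y
    cases w with
    | nil => exact hy rfl
    | cons hadj _ =>
      obtain ⟨hne, z, hz, hzx⟩ := (isConnectionSet_residues hneg (p ^ 1)).adj_iff.1 hadj
      have := hinj 0 h1 hN1 z hz 0 h0 (Subsingleton.elim (α := ZMod 1) _ _)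
      rw [zero_add, hzx] at this
      exact hne (by simpa using this)
  obtain ⟨l, k, hlk, hl, hk, hsum, hprod, hlift⟩ := exists_isLift_residues hp hn0 hneg h0 hconnM
    hfull hinj h1 hN1 le_rfl n (hpN N le_rfl) dvd_rfl (by
      intro z hz w hw h
      obtain ⟨a, ha, haz⟩ := hrep z hz
      obtain ⟨b, hb, hbw⟩ := hrep w hw
      rw [haz n dvd_rfl, hbw n dvd_rfl]
      rw [haz _ (hpN N le_rfl), hbw _ (hpN N le_rfl)] at h
      rw [eq_of_cast_eq hcyc' hA'card ha hb h])
  rw [Finset.inter_eq_left.2 hEN, hE] at hsum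
  rw [hres] at hlift
  rw [hsum, hn, mul_comm] at hprod
  exact ⟨l, k, hlk, hl, hk, hsum,
    Nat.eq_of_mul_eq_mul_left (pow_pos hp.pos ℓ) hprod, hlift⟩

theorem ncard_extSet_of_iso {V : Type*} {Γ : SimpleGraph V} [Γ.LocallyFinite] {n d : ℕ}
    {S : Set (ZMod n)} (hS : IsConnectionSet S) (f : Γ ≃g SimpleGraph.circulantGraph S)
    (hdeg : Γ.IsRegularOfDegree d) [NeZero n] : (extSet S).ncard = d + 1 := by
  have h : (SimpleGraph.circulantGraph S).neighborSet 0 = S := by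
    ext x
    rw [SimpleGraph.mem_neighborSet, SimpleGraph.adj_comm, hS.adj_iff, sub_zero]
  rw [extSet, Set.ncard_insert_of_notMem hS.1 (Set.toFinite S)]
  have hc := Nat.card_congr (f.mapNeighborSet (f.symm 0))
  rw [Nat.card_eq_fintype_card, SimpleGraph.card_neighborSet_eq_degree, hdeg,
    Nat.card_coe_set_eq, RelIso.apply_symm_apply, h] at hc
  rw [hc]

end PerfectCirculant

theorem theorem1p3 (p ℓ m n : ℕ) (hp : p.Prime) (hℓ : 1 ≤ ℓ) (hm : 2 ≤ m) (hn : n = p ^ ℓ * m)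
    {V : Type*} (Γ : SimpleGraph V) [Γ.LocallyFinite]
    (hcirc : PerfectCirculant.IsCirculant Γ n) (hconn : Γ.Connected)
    (hdeg : Γ.IsRegularOfDegree (p ^ ℓ - 1)) :
    (∃ D : Set V, PerfectCirculant.IsPerfectCode Γ D) ↔
      ∃ l k : List ℕ, l.length = k.length ∧ (∀ a ∈ l, 0 < a) ∧ (∀ b ∈ k, 0 < b) ∧
        l.sum = ℓ ∧ k.prod = m ∧
        ∃ Λ ∈ PerfectCirculant.liftFamily p l k n, Nonempty (Γ ≃g Λ) := by
  have hm0 : m ≠ 0 := by omega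
  have hn0 : n ≠ 0 := by rw [hn]; exact mul_ne_zero (pow_ne_zero _ hp.ne_zero) hm0
  have : NeZero n := ⟨hn0⟩
  constructor
  · rintro ⟨D, hD⟩
    obtain ⟨S, hS, ⟨f⟩⟩ := hcirc
    have hcard : (PerfectCirculant.extSet S).ncard = p ^ ℓ := by
      rw [PerfectCirculant.ncard_extSet_of_iso hS f hdeg,
        Nat.sub_add_cancel (Nat.one_le_pow _ _ hp.pos)]
    obtain ⟨l, k, hlk, hl, hk, hsum, hprod, hlift⟩ :=
      PerfectCirculant.exists_isLift_of_tiles hp hℓ hm0 hn hS (f.connected_iff.1 hconn) hcard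
        ((PerfectCirculant.isPerfectCode_circulantGraph_iff hS).1 (hD.map_iso f))
    exact ⟨l, k, hlk, hl, hk, hsum, hprod, _, ⟨S, hlift, rfl⟩, ⟨f⟩⟩
  · rintro ⟨l, k, -, -, -, -, -, _, ⟨T, hT, rfl⟩, ⟨f⟩⟩
    obtain ⟨hTc, D, hD⟩ := hT.exists_tiles hn0
    exact ⟨_, ((PerfectCirculant.isPerfectCode_circulantGraph_iff hTc).2 hD).map_iso f.symm⟩
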